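/- **Theorem (Recovery of eigenvectors from Lagrange linearizations).** Let $k\ge 1$, let $x_1,\dots,x_{k+1}\in\mathbb{C}$ be distinct nodes, and put $\gamma_i(\lambda)=\lambda-x_i$, $\ell(\lambda)=\prod_{i=1}^{k+1}\gamma_i(\lambda)$ and $w_i=1/\prod_{j\ne i}(x_i-x_j)$. Let $P_1,\dots,P_{k+1}\in\mathbb{C}^{n\times n}$ and let $$P(\lambda)=\ell(\lambda)\sum_{i=1}^{k+1}P_i\,\frac{w_i}{\gamma_i(\lambda)},$$ considered as a matrix polynomial of grade $k$; assume that $P$ is regular, i.e. $\det P(\lambda)\not\equiv 0$. Let $0\le\mu\le k-1$ be an integer. Let $K_1(\lambda)$ be the pencil with $k-\mu-1$ block rows and $k-\mu$ block columns whose $r$-th block row has $\gamma_{k+2-r}(\lambda)I_n$ in block column $r$, $-\gamma_{k-r}(\lambda)I_n$ in block column $r+1$, and zeros elsewhere. Let $K_2(\lambda)$ be the pencil with $\mu$ block rows and $\mu+1$ block columns whose $r$-th block row has $\gamma_{\mu+3-r}(\lambda)I_n$ in block column $r$, $-\gamma_{\mu+1-r}(\lambda)I_n$ in block column $r+1$,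 and zeros elsewhere. (An empty pencil is allowed.) Let $M(\lambda)$ be the pencil with $\mu+1$ block rows and $k-\mu$ block columns, of $n\times n$ blocks, whose first block row is $$\begin{bmatrix}P_{k+1}w_{k+1}\gamma_k(\lambda)+P_kw_k\gamma_{k+1}(\lambda) & P_{k-1}w_{k-1}\gamma_k(\lambda) & P_{k-2}w_{k-2}\gamma_{k-1}(\lambda) & \cdots & P_{\mu+1}w_{\mu+1}\gamma_{\mu+2}(\lambda)\end{bmatrix}$$ (only the first entry if $\mu=k-1$), whose last block column has, below its first block, the blocks $P_\mu w_\mu\gamma_{\mu+1}(\lambda),\dots,P_2w_2\gamma_3(\lambda),P_1w_1\gamma_2(\lambda)$, and whose other blocks are zero. A *Lagrange linearization* of $P$ is a pencil $$L(\lambda)=\begin{bmatrix}M(\lambda)+A\,K_1(\lambda)+K_2(\lambda)^TB & K_2(\lambda)^T\\ K_1(\lambda)&0\end{bmatrix}$$ with arbitrary constant matrices $A\in\mathbb{C}^{(\mu+1)n\times(k-\mu-1)n}$ and $B\in\mathbb{C}^{\mu n\times(k-\mu)n}$. For a matrix polynomial $Q$ of grade $d$, a nonzero vector $v$ is a right (left)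 eigenvector of $Q$ associated with $\lambda_0\in\mathbb{C}$ if $Q(\lambda_0)v=0$ (respectively $v^TQ(\lambda_0)=0$), and associated with $\lambda_0=\infty$ if the same holds with $Q(\lambda_0)$ replaced by the value at $0$ of the reversal $\operatorname{rev}_dQ(\lambda)=\lambda^dQ(1/\lambda)$. Here $P$ has grade $k$ and $L$ has grade $1$. An eigenvalue of $Q$ is a $\lambda_0\in\mathbb{C}\cup\{\infty\}$ with which a right eigenvector is associated. Let $\lambda_0$ be an eigenvalue of $P$ that is either infinite, or finite and not one of the nodes $x_1,\dots,x_{k+1}$. Then for every Lagrange linearization $L$ of $P$: 1. if $z$ is a right eigenvector of $L$ associated with $\lambda_0$, then each of its first $k-\mu$ block entries $z(1),\dots,z(k-\mu)\in\mathbb{C}^n$ is a right eigenvector of $P$ associated with $\lambda_0$; 2. if $\omega$ is a left eigenvector of $L$ associated with $\lambda_0$, then each of its first $\mu+1$ block entries $\omega(1),\dots,\omega(\mu+1)\in\mathbb{C}^n$ is a left eigenvector of $P$ associated with $\lambda_0$. -/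

import Mathlib

open Polynomial Matrix OnePoint

noncomputable section

namespace LagrangeLin

/-! ### Matrix polynomials: reversal, eigenvalues, eigenvectors -/

/-- A matrix polynomial is regular if it is square and its determinant is not identically zero. -/
def IsRegular {m : Type*} [Fintype m] [DecidableEq m] (P : Matrix m m ℂ[X]) : Prop :=
  P.det ≠ 0

/-- The `d`-reversal `λ ^ d * P (1 / λ)` of a matrix polynomial of grade `d`. -/
def rev {r c : Type*} (d : ℕ) (P : Matrix r c ℂ[X]) : Matrix r c ℂ[X] :=
  P.map (Polynomial.reflect d)

/-- The constant matrix whose null vectors are the eigenvectors of the grade-`d` matrix polynomial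
`P` at the point `t` of the extended plane: `P(a)` at a finite point `a`, and the value at `0` of
the `d`-reversal of `P` at infinity. -/
def valueAt {r c : Type*} (d : ℕ) (P : Matrix r c ℂ[X]) : OnePoint ℂ → Matrix r c ℂ
  | ∞ => (rev d P).map (Polynomial.eval 0)
  | (a : ℂ) => P.map (Polynomial.eval a)

/-- `v` is a right eigenvector, associated with `t`, of `P` regarded as having grade `d`. -/
def IsRightEigenvector {r c : Type*} [Fintype c] (d : ℕ) (P : Matrix r c ℂ[X])
    (t : OnePoint ℂ) (v : c → ℂ) : Prop :=
  v ≠ 0 ∧ valueAt d P t *ᵥ v = 0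

/-- `v` is a left eigenvector, associated with `t`, of `P` regarded as having grade `d`
(plain transpose, no conjugation). -/
def IsLeftEigenvector {r c : Type*} [Fintype r] (d : ℕ) (P : Matrix r c ℂ[X])
    (t : OnePoint ℂ) (v : r → ℂ) : Prop :=
  v ≠ 0 ∧ v ᵥ* valueAt d P t = 0

/-- `t` is a finite or infinite eigenvalue of `P` regarded as having grade `d`. -/
def IsEigenvalue {r c : Type*} [Fintype c] (d : ℕ) (P : Matrix r c ℂ[X])
    (t : OnePoint ℂ) : Prop :=
  ∃ v : c → ℂ, IsRightEigenvector d P t v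

/-! ### The modified (barycentric) Lagrange form

The nodes `x 1, …, x (k + 1)` and the coefficients `Pc 1, …, Pc (k + 1)` are indexed from `1`;
values of `x` and `Pc` at other indices are never used. -/

/-- The polynomial `γ_i(λ) = λ - x_i`. -/
def γ (x : ℕ → ℂ) (i : ℕ) : ℂ[X] := X - C (x i)

/-- The polynomial `ℓ(λ) = (λ - x_1) ⋯ (λ - x_{k+1})`. -/
def ell (k : ℕ) (x : ℕ → ℂ) : ℂ[X] := ∏ i ∈ Finset.Icc 1 (k + 1), γ x i

/-- The barycentric weight `w_i = 1 / ∏_{j ≠ i} (x_i - x_j)`. -/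
def weight (k : ℕ) (x : ℕ → ℂ) (i : ℕ) : ℂ :=
  1 / ∏ j ∈ (Finset.Icc 1 (k + 1)).erase i, (x i - x j)

/-- The matrix polynomial `P(λ) = ∑_{i=1}^{k+1} P_i w_i ℓ(λ) / γ_i(λ)`, each quotient
`ℓ(λ) / γ_i(λ)` being an exact division of polynomials. -/
def lagrangePoly {n : ℕ} (k : ℕ) (x : ℕ → ℂ) (Pc : ℕ → Matrix (Fin n) (Fin n) ℂ) :
    Matrix (Fin n) (Fin n) ℂ[X] :=
  ∑ i ∈ Finset.Icc 1 (k + 1), (C (weight k x i) * (ell k x / γ x i)) • (Pc i).map C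

/-! ### Lagrange linearizations

Block rows and block columns are indexed from `0` by `Fin`, so that block entry `r : Fin _`
below is the entry number `r + 1`. -/

/-- The pencil `K₁`, with `k - μ - 1` block rows and `k - μ` block columns: block row number `r`
(counted from `1`) has `γ_{k+2-r} I` in block column `r` and `-γ_{k-r} I` in block
column `r + 1`. -/
def K₁ (n k μ : ℕ) (x : ℕ → ℂ) :
    Matrix (Fin (k - μ - 1) × Fin n) (Fin (k - μ) × Fin n) ℂ[X] :=
  fun a b =>
    if a.2 = b.2 then
      if (b.1 : ℕ) = a.1 then γ x (k + 1 - a.1)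
      else if (b.1 : ℕ) = a.1 + 1 then -γ x (k - 1 - a.1)
      else 0
    else 0

/-- The pencil `K₂`, with `μ` block rows and `μ + 1` block columns: block row number `r`
(counted from `1`) has `γ_{μ+3-r} I` in block column `r` and `-γ_{μ+1-r} I` in block
column `r + 1`. -/
def K₂ (n μ : ℕ) (x : ℕ → ℂ) :
    Matrix (Fin μ × Fin n) (Fin (μ + 1) × Fin n) ℂ[X] :=
  fun a b =>
    if a.2 = b.2 then
      if (b.1 : ℕ) = a.1 then γ x (μ + 2 - a.1)
      else if (b.1 : ℕ) = a.1 + 1 then -γ x (μ - a.1)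
      else 0
    else 0

/-- The block in block row `r` and block column `c` (counted from `0`) of the body of the colleague
Lagrange pencil. -/
def bodyBlock {n : ℕ} (k μ : ℕ) (x : ℕ → ℂ) (Pc : ℕ → Matrix (Fin n) (Fin n) ℂ) (r c : ℕ) :
    Matrix (Fin n) (Fin n) ℂ[X] :=
  if r = 0 then
    if c = 0 then
      (C (weight k x (k + 1)) * γ x k) • (Pc (k + 1)).map C
        + (C (weight k x k) * γ x (k + 1)) • (Pc k).map C
    else (C (weight k x (k - c)) * γ x (k + 1 - c)) • (Pc (k - c)).map C
  else if c = k - μ - 1 then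
    (C (weight k x (μ + 1 - r)) * γ x (μ + 2 - r)) • (Pc (μ + 1 - r)).map C
  else 0

/-- The body `M` of the colleague Lagrange pencil, with `μ + 1` block rows and `k - μ` block
columns: its first block row is
`[P_{k+1} w_{k+1} γ_k + P_k w_k γ_{k+1}, P_{k-1} w_{k-1} γ_k, …, P_{μ+1} w_{μ+1} γ_{μ+2}]`,
the remaining blocks of its last block column are `P_μ w_μ γ_{μ+1}, …, P_1 w_1 γ_2`, and its other
blocks are zero. -/
def body {n : ℕ} (k μ : ℕ) (x : ℕ → ℂ) (Pc : ℕ → Matrix (Fin n) (Fin n) ℂ) :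
    Matrix (Fin (μ + 1) × Fin n) (Fin (k - μ) × Fin n) ℂ[X] :=
  fun a b => bodyBlock k μ x Pc a.1 b.1 a.2 b.2

/-- The Lagrange linearization `[M + A K₁ + K₂ᵀ B, K₂ᵀ; K₁, 0]` determined by the constant
matrices `A` and `B`; it is a pencil with `k` block rows and `k` block columns of size `n`. -/
def lagrangeLinearization {n : ℕ} (k μ : ℕ) (x : ℕ → ℂ) (Pc : ℕ → Matrix (Fin n) (Fin n) ℂ)
    (A : Matrix (Fin (μ + 1) × Fin n) (Fin (k - μ - 1) × Fin n) ℂ)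
    (B : Matrix (Fin μ × Fin n) (Fin (k - μ) × Fin n) ℂ) :
    Matrix ((Fin (μ + 1) × Fin n) ⊕ (Fin (k - μ - 1) × Fin n))
      ((Fin (k - μ) × Fin n) ⊕ (Fin μ × Fin n)) ℂ[X] :=
  Matrix.fromBlocks
    (body k μ x Pc + A.map C * K₁ n k μ x + (K₂ n μ x)ᵀ * B.map C) (K₂ n μ x)ᵀ
    (K₁ n k μ x) 0

/-- The block entry number `i + 1` of a block vector, for `i` among the leading `p` blocks. -/
def topBlock {n p q : ℕ} (z : (Fin p × Fin n) ⊕ (Fin q × Fin n) → ℂ) (i : Fin p) : Fin n → ℂ :=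
  fun j => z (Sum.inl (i, j))

end LagrangeLin

end

noncomputable section

namespace LagrangeLin

/-! ### Evaluation at a point of the extended plane -/

/-! Fix the point `t` and let `g i` be the value of `γ_i` there in grade one, which is `1` at
infinity; the finite and infinite cases then become one. Off the nodes every `g i` is nonzero, and
the value of `P` is a nonzero multiple of the matrix `∑ P_i w_i / g_i`.

The values of `K₁` and `K₂` are block bidiagonal, with trivial left kernel and with right kernels
parametrized by explicit block columns `Y` and `S` (`exists_eq_dualBasis_mulVec`,
`eq_zero_of_vecMul_bidiag`). The body is built so that `Sᵀ M Y` is again a nonzero multiple of `∑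
P_i w_i / g_i` (`dualBasis_mul_body_mul_dualBasis`).

If `(y, u)` is a right null vector of `L`, its second block row forces `y = Y h`. The first then
reads `M Y h + K₂ᵀ (B Y h + u) = 0`, and multiplying by `Sᵀ` kills the second term, so `h` is a null
vector of the value of `P`. Every block of `y` is a nonzero multiple of `h`, and `h = 0` would force
`u = 0`. The left case is the same with `S` and `Y` exchanged. -/

/-- The value at `t` of a scalar polynomial of grade `d`. -/
def evalAt (d : ℕ) : OnePoint ℂ → ℂ[X] →ₗ[ℂ] ℂ
  | ∞ => Polynomial.lcoeff ℂ d
  | (a : ℂ) => Polynomial.leval a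

/-- The value at `t` of `λ - x_i`, as a polynomial of grade one. -/
def nodeValue (x : ℕ → ℂ) (t : OnePoint ℂ) (i : ℕ) : ℂ := evalAt 1 t (γ x i)

lemma valueAt_eq_map {r c : Type*} (d : ℕ) (P : Matrix r c ℂ[X]) (t : OnePoint ℂ) :
    valueAt d P t = P.map (evalAt d t) := by
  induction t using OnePoint.rec with
  | infty =>
    ext i j
    change eval 0 (Polynomial.reflect d (P i j)) = (P i j).coeff d
    rw [← Polynomial.coeff_zero_eq_eval_zero, Polynomial.coeff_reflect]
    simp [Polynomial.revAt_le]
  | coe a => rfl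

lemma evalAt_C_mul (d : ℕ) (t : OnePoint ℂ) (c : ℂ) (p : ℂ[X]) :
    evalAt d t (C c * p) = c * evalAt d t p := by
  rw [← Polynomial.smul_eq_C_mul, LinearMap.map_smul, smul_eq_mul]

lemma evalAt_mul_C (d : ℕ) (t : OnePoint ℂ) (c : ℂ) (p : ℂ[X]) :
    evalAt d t (p * C c) = evalAt d t p * c := by
  rw [mul_comm, evalAt_C_mul, mul_comm]

lemma nodeValue_ne_zero (x : ℕ → ℂ) (t : OnePoint ℂ) (i : ℕ) (h : t ≠ (x i : OnePoint ℂ)) :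
    nodeValue x t i ≠ 0 := by
  induction t using OnePoint.rec with
  | infty =>
    change (X - C (x i) : ℂ[X]).coeff 1 ≠ 0
    simp
  | coe a =>
    change eval a (X - C (x i) : ℂ[X]) ≠ 0
    simpa [sub_eq_zero] using h

/-- The grade equals the number of factors, so at infinity the value is the leading coefficient of a
monic polynomial. -/
lemma evalAt_prod_gamma (x : ℕ → ℂ) (t : OnePoint ℂ) (s : Finset ℕ) :
    evalAt s.card t (∏ i ∈ s, γ x i) = ∏ i ∈ s, nodeValue x t i := by
  induction t using OnePoint.rec with
  | infty =>
    have h1 : ∀ i, nodeValue x ∞ i = 1 := fun i => by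
      change (X - C (x i) : ℂ[X]).coeff 1 = 1
      simp
    simp only [h1, Finset.prod_const_one]
    change (∏ i ∈ s, (X - C (x i))).coeff s.card = 1
    have hm : (∏ i ∈ s, (X - C (x i))).Monic :=
      Polynomial.monic_prod_of_monic _ _ fun i _ => monic_X_sub_C _
    have hd : (∏ i ∈ s, (X - C (x i))).natDegree = s.card := by
      rw [Polynomial.natDegree_prod_of_monic _ _ fun i _ => monic_X_sub_C _]
      simp
    rw [← hd]
    exact hm
  | coe a =>
    change eval a (∏ i ∈ s, γ x i) = ∏ i ∈ s, eval a (γ x i)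
    exact Polynomial.eval_prod _ _ _

lemma ell_div_gamma (k : ℕ) (x : ℕ → ℂ) {i : ℕ} (hi : i ∈ Finset.Icc 1 (k + 1)) :
    ell k x / γ x i = ∏ j ∈ (Finset.Icc 1 (k + 1)).erase i, γ x j := by
  rw [ell, ← Finset.mul_prod_erase _ _ hi]
  exact mul_div_cancel_left₀ _ (Polynomial.X_sub_C_ne_zero _)

/-- The matrix `∑ P_i w_i / g_i`. -/
def barycentricSum {n : ℕ} (k : ℕ) (x : ℕ → ℂ) (g : ℕ → ℂ)
    (Pc : ℕ → Matrix (Fin n) (Fin n) ℂ) : Matrix (Fin n) (Fin n) ℂ :=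
  ∑ i ∈ Finset.Icc 1 (k + 1), (weight k x i / g i) • Pc i

lemma valueAt_lagrangePoly {n : ℕ} (k : ℕ) (x : ℕ → ℂ) (Pc : ℕ → Matrix (Fin n) (Fin n) ℂ)
    (t : OnePoint ℂ) (hg : ∀ i ∈ Finset.Icc 1 (k + 1), nodeValue x t i ≠ 0) :
    valueAt k (lagrangePoly k x Pc) t =
      (∏ i ∈ Finset.Icc 1 (k + 1), nodeValue x t i) •
        barycentricSum k x (nodeValue x t) Pc := by
  rw [valueAt_eq_map]
  ext a b
  simp only [lagrangePoly, barycentricSum, Matrix.map_apply, Matrix.sum_apply, Matrix.smul_apply,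
    smul_eq_mul, map_sum, Finset.mul_sum]
  refine Finset.sum_congr rfl fun i hi => ?_
  rw [evalAt_mul_C, evalAt_C_mul, ell_div_gamma k x hi]
  have hc : ((Finset.Icc 1 (k + 1)).erase i).card = k := by
    rw [Finset.card_erase_of_mem hi]; simp
  have h := evalAt_prod_gamma x t ((Finset.Icc 1 (k + 1)).erase i)
  rw [hc] at h
  rw [h, ← Finset.mul_prod_erase _ _ hi]
  field_simp [hg i hi]

/-! ### Block bidiagonal matrices -/

/-- The block bidiagonal matrix whose block row `r`, counted from `0`, has `g (N - r)` in block
column `r` and `-g (N - 2 - r)` in block column `r + 1`. -/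
def bidiag (n N p q : ℕ) (g : ℕ → ℂ) : Matrix (Fin q × Fin n) (Fin p × Fin n) ℂ :=
  fun a b =>
    if a.2 = b.2 then
      if (b.1 : ℕ) = a.1 then g (N - a.1)
      else if (b.1 : ℕ) = a.1 + 1 then -g (N - 2 - a.1)
      else 0
    else 0

/-- The block column spanning the kernel of `bidiag`. -/
def dualBasis (n N p : ℕ) (g : ℕ → ℂ) : Matrix (Fin p × Fin n) (Fin n) ℂ :=
  fun a j => if a.2 = j then 1 / (g (N - a.1) * g (N - 1 - a.1)) else 0

variable {n N p q : ℕ} {g : ℕ → ℂ}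

lemma bidiag_mulVec (hpq : p = q + 1) (y : Fin p × Fin n → ℂ) (r : Fin q) (j : Fin n) :
    (bidiag n N p q g *ᵥ y) (r, j) =
      g (N - r) * y (⟨r, by omega⟩, j) - g (N - 2 - r) * y (⟨r + 1, by omega⟩, j) := by
  have h : ∀ c : Fin p, (∑ j' : Fin n, bidiag n N p q g (r, j) (c, j') * y (c, j')) =
      (if c = ⟨r, by omega⟩ then g (N - r) * y (c, j) else 0) +
        (if c = ⟨r + 1, by omega⟩ then -g (N - 2 - r) * y (c, j) else 0) := by
    intro c
    simp only [bidiag, ite_mul, zero_mul, Finset.sum_ite_eq, Finset.mem_univ, if_true]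
    simp only [Fin.ext_iff]
    by_cases h1 : (c : ℕ) = r
    · simp [h1]
    · simp [h1]
  rw [Matrix.mulVec, dotProduct, Fintype.sum_prod_type]
  simp only [h, Finset.sum_add_distrib, Finset.sum_ite_eq', Finset.mem_univ, if_true]
  ring

lemma dualBasis_mulVec (h : Fin n → ℂ) (r : Fin p) (j : Fin n) :
    (dualBasis n N p g *ᵥ h) (r, j) = 1 / (g (N - r) * g (N - 1 - r)) * h j := by
  simp [Matrix.mulVec, dotProduct, dualBasis]

/-- In row `r` both products reduce to `1 / g (N - 1 - r)`. The bound on `N` keeps every index at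
least `1`, where `g` is known not to vanish. -/
lemma bidiag_mul_dualBasis (hpq : p = q + 1) (hN : q + 2 ≤ N)
    (hg : ∀ i, 1 ≤ i → i ≤ N → g i ≠ 0) : bidiag n N p q g * dualBasis n N p g = 0 := by
  refine Matrix.ext_of_mulVec_single fun j' => ?_
  rw [← Matrix.mulVec_mulVec, Matrix.zero_mulVec]
  ext ⟨r, j⟩
  have hr := r.2
  rw [bidiag_mulVec hpq, dualBasis_mulVec, dualBasis_mulVec]
  have h0 := hg (N - r) (by omega) (by omega)
  have h1 := hg (N - 1 - r) (by omega) (by omega)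
  have h2 := hg (N - 2 - r) (by omega) (by omega)
  have e1 : N - (r + 1 : ℕ) = N - 1 - r := by omega
  have e2 : N - 1 - (r + 1 : ℕ) = N - 2 - r := by omega
  simp only [e1, e2, Pi.zero_apply]
  field_simp
  ring

lemma exists_eq_dualBasis_mulVec (hpq : p = q + 1) (hN : q + 2 ≤ N)
    (hg : ∀ i, 1 ≤ i → i ≤ N → g i ≠ 0) (y : Fin p × Fin n → ℂ)
    (hy : bidiag n N p q g *ᵥ y = 0) : ∃ h, y = dualBasis n N p g *ᵥ h := by
  refine ⟨fun j => g N * g (N - 1) * y (⟨0, by omega⟩, j), ?_⟩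
  -- Row `r` of the system, multiplied by `g (N - 1 - r)`, says that this product takes the same
  -- value at `r` and `r + 1`.
  have key : ∀ (r : ℕ) (hr : r < p) (j : Fin n),
      g (N - r) * g (N - 1 - r) * y (⟨r, hr⟩, j) =
        g N * g (N - 1) * y (⟨0, by omega⟩, j) := by
    intro r
    induction r with
    | zero => intro hr j; simp
    | succ r ih =>
      intro hr j
      rw [← ih (by omega) j]
      have h := congrFun hy (⟨r, by omega⟩, j)
      rw [bidiag_mulVec hpq] at h
      have e1 : N - (r + 1 : ℕ) = N - 1 - r := by omega
      have e2 : N - 1 - (r + 1 : ℕ) = N - 2 - r := by omega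
      simp only [Pi.zero_apply] at h
      rw [e1, e2]
      linear_combination -g (N - 1 - r) * h
  ext ⟨r, j⟩
  have hr := r.2
  rw [dualBasis_mulVec, ← key r hr j]
  have h0 := hg (N - r) (by omega) (by omega)
  have h1 := hg (N - 1 - r) (by omega) (by omega)
  field_simp

/-- The first `q` block columns are upper triangular with invertible diagonal blocks, so `u`
vanishes by forward substitution. -/
lemma eq_zero_of_vecMul_bidiag (hpq : p = q + 1) (hN : q + 2 ≤ N)
    (hg : ∀ i, 1 ≤ i → i ≤ N → g i ≠ 0) (u : Fin q × Fin n → ℂ)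
    (hu : u ᵥ* bidiag n N p q g = 0) : u = 0 := by
  have key : ∀ (r : ℕ) (hr : r < q) (j : Fin n), u (⟨r, hr⟩, j) = 0 := by
    intro r
    induction r with
    | zero =>
      intro hr j
      have h := congrFun hu (⟨0, by omega⟩, j)
      have h' : ∀ a : Fin q, (∑ j' : Fin n, u (a, j') *
          bidiag n N p q g (a, j') (⟨0, by omega⟩, j)) =
          if a = ⟨0, hr⟩ then u (a, j) * g N else 0 := by
        intro a
        simp only [bidiag, mul_ite, mul_zero, Finset.sum_ite_eq', Finset.mem_univ, if_true]
        simp only [Fin.ext_iff]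
        by_cases h1 : (a : ℕ) = 0
        · simp [h1]
        · simp [h1, Ne.symm h1]
      rw [Matrix.vecMul, dotProduct, Fintype.sum_prod_type] at h
      simp only [h', Finset.sum_ite_eq', Finset.mem_univ, if_true] at h
      exact (mul_eq_zero.mp h).resolve_right (hg N (by omega) le_rfl)
    | succ r ih =>
      intro hr j
      have h := congrFun hu (⟨r + 1, by omega⟩, j)
      have h' : ∀ a : Fin q, (∑ j' : Fin n, u (a, j') *
          bidiag n N p q g (a, j') (⟨r + 1, by omega⟩, j)) =
          if a = ⟨r + 1, hr⟩ then u (a, j) * g (N - (r + 1)) else 0 := by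
        intro a
        simp only [bidiag, mul_ite, mul_zero, Finset.sum_ite_eq', Finset.mem_univ, if_true]
        simp only [Fin.ext_iff]
        by_cases h1 : (a : ℕ) = r + 1
        · simp [h1]
        · by_cases h2 : (a : ℕ) = r
          · have hu0 : u (a, j) = 0 := by
              have h3 := ih (Nat.lt_of_succ_lt hr) j
              rwa [show a = ⟨r, Nat.lt_of_succ_lt hr⟩ from Fin.ext h2]
            simp [hu0]
          · simp [h1, Ne.symm h1, Ne.symm h2]
      rw [Matrix.vecMul, dotProduct, Fintype.sum_prod_type] at h
      simp only [h', Finset.sum_ite_eq', Finset.mem_univ, if_true] at h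
      exact (mul_eq_zero.mp h).resolve_right (hg _ (by omega) (by omega))
  ext ⟨r, j⟩
  exact key r r.2 j

/-! ### Values of the pencils -/

lemma map_K₁ (k μ : ℕ) (x : ℕ → ℂ) (t : OnePoint ℂ) :
    (K₁ n k μ x).map (evalAt 1 t) = bidiag n (k + 1) (k - μ) (k - μ - 1) (nodeValue x t) := by
  ext a b
  simp only [Matrix.map_apply, K₁, bidiag, nodeValue, apply_ite (evalAt 1 t), map_neg, map_zero]
  rfl

lemma map_K₂ (μ : ℕ) (x : ℕ → ℂ) (t : OnePoint ℂ) :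
    (K₂ n μ x).map (evalAt 1 t) = bidiag n (μ + 2) (μ + 1) μ (nodeValue x t) := by
  ext a b
  simp only [Matrix.map_apply, K₂, bidiag, nodeValue, apply_ite (evalAt 1 t), map_neg, map_zero]
  rfl

lemma valueAt_lagrangeLinearization (k μ : ℕ) (x : ℕ → ℂ) (Pc : ℕ → Matrix (Fin n) (Fin n) ℂ)
    (A : Matrix (Fin (μ + 1) × Fin n) (Fin (k - μ - 1) × Fin n) ℂ)
    (B : Matrix (Fin μ × Fin n) (Fin (k - μ) × Fin n) ℂ) (t : OnePoint ℂ) :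
    valueAt 1 (lagrangeLinearization k μ x Pc A B) t =
      Matrix.fromBlocks
        ((body k μ x Pc).map (evalAt 1 t) +
          A * bidiag n (k + 1) (k - μ) (k - μ - 1) (nodeValue x t) +
          (bidiag n (μ + 2) (μ + 1) μ (nodeValue x t))ᵀ * B)
        (bidiag n (μ + 2) (μ + 1) μ (nodeValue x t))ᵀ
        (bidiag n (k + 1) (k - μ) (k - μ - 1) (nodeValue x t)) 0 := by
  rw [valueAt_eq_map, lagrangeLinearization, Matrix.fromBlocks_map, ← map_K₁, ← map_K₂]
  congr 1
  · ext a b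
    simp only [Matrix.map_apply, Matrix.add_apply, Matrix.mul_apply, map_add, map_sum,
      evalAt_C_mul, evalAt_mul_C, Matrix.transpose_apply]
  · ext a b
    simp

/-! ### Compression of the body to the barycentric sum -/

lemma sum_Icc_split {q μ : ℕ} (f : ℕ → ℂ) :
    ∑ i ∈ Finset.Icc 1 (μ + q + 2), f i =
      f (μ + q + 2) + f (μ + q + 1) + ∑ c ∈ Finset.range q, f (μ + q - c) +
        ∑ r ∈ Finset.range μ, f (μ - r) := by
  have h1 : ∑ r ∈ Finset.range μ, f (μ - r) = ∑ r ∈ Finset.range μ, f (r + 1) := by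
    rw [← Finset.sum_range_reflect]
    refine Finset.sum_congr rfl fun i hi => ?_
    have := Finset.mem_range.mp hi
    congr 1; omega
  have h2 : ∑ c ∈ Finset.range q, f (μ + q - c) = ∑ c ∈ Finset.range q, f (μ + c + 1) := by
    rw [← Finset.sum_range_reflect]
    refine Finset.sum_congr rfl fun i hi => ?_
    have := Finset.mem_range.mp hi
    congr 1; omega
  have h3 : ∑ i ∈ Finset.Icc 1 (μ + q + 2), f i = ∑ i ∈ Finset.range (μ + q + 2), f (i + 1) := by
    rw [Finset.range_eq_Ico, Finset.sum_Ico_add' f 0 (μ + q + 2) 1]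
    rfl
  rw [h3, Finset.sum_range_succ, Finset.sum_range_succ, Finset.sum_range_add, h1, h2]
  ring

lemma sum_row_column {q μ p : ℕ} (hpq : p = q + 1) (F : ℕ → ℕ → ℂ)
    (hF : ∀ r c, r ≠ 0 → c ≠ q → F r c = 0) :
    ∑ r : Fin (μ + 1), ∑ c : Fin p, F r c =
      F 0 0 + ∑ c ∈ Finset.range q, F 0 (c + 1) + ∑ r ∈ Finset.range μ, F (r + 1) q := by
  subst hpq
  have h1 : ∀ r : ℕ, ∑ c : Fin (q + 1), F (r + 1) c = F (r + 1) q := fun r => by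
    rw [Fin.sum_univ_eq_sum_range (F (r + 1)), Finset.sum_range_succ,
      Finset.sum_eq_zero, zero_add]
    intro c hc
    exact hF _ _ r.succ_ne_zero (Finset.mem_range.mp hc).ne
  have h2 : ∑ c : Fin (q + 1), F 0 c = F 0 0 + ∑ c ∈ Finset.range q, F 0 (c + 1) := by
    rw [Fin.sum_univ_eq_sum_range (F 0), Finset.sum_range_succ', add_comm]
  rw [Fin.sum_univ_eq_sum_range (fun r => ∑ c : Fin (q + 1), F r c), Finset.sum_range_succ',
    add_comm, h2]
  simp only [h1]

/-- Along the first block row the left factor is constantly `1 / (g (μ + 2) * g (μ + 1))`; down the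
last block column the right factor is the same constant. The other factor cancels the `γ` in each
body block and leaves `1 / g i`. -/
lemma dualBasis_mul_body_mul_dualBasis {k μ : ℕ} (hμ : μ < k) (x : ℕ → ℂ)
    (Pc : ℕ → Matrix (Fin n) (Fin n) ℂ) (t : OnePoint ℂ)
    (hg : ∀ i, 1 ≤ i → i ≤ k + 1 → nodeValue x t i ≠ 0) :
    (dualBasis n (μ + 2) (μ + 1) (nodeValue x t))ᵀ * (body k μ x Pc).map (evalAt 1 t) *
        dualBasis n (k + 1) (k - μ) (nodeValue x t) =
      (1 / (nodeValue x t (μ + 2) * nodeValue x t (μ + 1))) •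
        barycentricSum k x (nodeValue x t) Pc := by
  -- Here `q` is the index of the last block column; for `q = 0` the first row is its corner alone.
  obtain ⟨q, rfl⟩ : ∃ q, k = μ + q + 1 := ⟨k - μ - 1, by omega⟩
  set g := nodeValue x t
  have hq : μ + q + 1 - μ - 1 = q := by omega
  ext a b
  let F : ℕ → ℕ → ℂ := fun r c => 1 / (g (μ + 2 - r) * g (μ + 2 - 1 - r)) *
    evalAt 1 t (bodyBlock (μ + q + 1) μ x Pc r c a b) *
      (1 / (g (μ + q + 1 + 1 - c) * g (μ + q + 1 + 1 - 1 - c)))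
  have hsum : ((dualBasis n (μ + 2) (μ + 1) g)ᵀ *
      (body (μ + q + 1) μ x Pc).map (evalAt 1 t) *
        dualBasis n (μ + q + 1 + 1) (μ + q + 1 - μ) g) a b =
      ∑ r : Fin (μ + 1), ∑ c : Fin (μ + q + 1 - μ), F r c := by
    simp only [Matrix.mul_apply, Fintype.sum_prod_type, dualBasis, Matrix.transpose_apply,
      Matrix.map_apply, body, ite_mul, mul_ite, mul_zero, zero_mul, Finset.sum_ite_eq',
      Finset.mem_univ, if_true, Finset.sum_mul]
    rw [Finset.sum_comm]
  have hF : ∀ r c, r ≠ 0 → c ≠ q → F r c = 0 := fun r c hr hc => by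
    simp [F, bodyBlock, hr, hq, hc]
  have hγ : ∀ i, evalAt 1 t (γ x i) = g i := fun _ => rfl
  have hev : ∀ c i (Q : Matrix (Fin n) (Fin n) ℂ),
      evalAt 1 t (((C c * γ x i) • Q.map C) a b) = c * g i * Q a b := fun c i Q => by
    rw [Matrix.smul_apply, Matrix.map_apply, smul_eq_mul, evalAt_mul_C, evalAt_C_mul, hγ]
  rw [hsum, sum_row_column (by omega) F hF, Matrix.smul_apply, barycentricSum, Matrix.sum_apply,
    sum_Icc_split]
  simp only [Matrix.smul_apply, smul_eq_mul]
  set s := 1 / (g (μ + 2) * g (μ + 1)) with hs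
  have h0 : F 0 0 = s * (weight (μ + q + 1) x (μ + q + 2) / g (μ + q + 2) * Pc (μ + q + 2) a b +
      weight (μ + q + 1) x (μ + q + 1) / g (μ + q + 1) * Pc (μ + q + 1) a b) := by
    have e1 := hg (μ + q + 1) (by omega) (by omega)
    have e2 := hg (μ + q + 2) (by omega) (by omega)
    simp only [F, bodyBlock, if_true, Matrix.add_apply, map_add, hev]
    change s * _ * (1 / (g (μ + q + 2) * g (μ + q + 1))) = _
    change s * (weight (μ + q + 1) x (μ + q + 2) * g (μ + q + 1) * Pc (μ + q + 2) a b +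
      weight (μ + q + 1) x (μ + q + 1) * g (μ + q + 2) * Pc (μ + q + 1) a b) * _ = _
    field_simp
  have h1 : ∀ c ∈ Finset.range q, F 0 (c + 1) =
      s * (weight (μ + q + 1) x (μ + q - c) / g (μ + q - c) * Pc (μ + q - c) a b) := by
    intro c hc
    have hc' := Finset.mem_range.mp hc
    have e1 := hg (μ + q + 1 - c) (by omega) (by omega)
    have e2 := hg (μ + q - c) (by omega) (by omega)
    simp only [F, bodyBlock, if_true, Nat.succ_ne_zero, if_false, hev]
    have i1 : μ + q + 1 - (c + 1) = μ + q - c := by omega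
    have i2 : μ + q + 1 + 1 - (c + 1) = μ + q + 1 - c := by omega
    have i3 : μ + q + 1 + 1 - 1 - (c + 1) = μ + q - c := by omega
    rw [i1, i2, i3]
    change s * _ * _ = _
    field_simp
  have h2 : ∀ r ∈ Finset.range μ, F (r + 1) q =
      s * (weight (μ + q + 1) x (μ - r) / g (μ - r) * Pc (μ - r) a b) := by
    intro r hr
    have hr' := Finset.mem_range.mp hr
    have e1 := hg (μ + 1 - r) (by omega) (by omega)
    have e2 := hg (μ - r) (by omega) (by omega)
    have e3 := hg (μ + 2) (by omega) (by omega)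
    have e4 := hg (μ + 1) (by omega) (by omega)
    simp only [F, bodyBlock, hq, if_true, Nat.succ_ne_zero, if_false, hev]
    have i1 : μ + 1 - (r + 1) = μ - r := by omega
    have i2 : μ + 2 - (r + 1) = μ + 1 - r := by omega
    have i3 : μ + 2 - 1 - (r + 1) = μ - r := by omega
    have i4 : μ + q + 1 + 1 - q = μ + 2 := by omega
    have i5 : μ + q + 1 + 1 - 1 - q = μ + 1 := by omega
    rw [i1, i2, i3, i4, i5, hs]
    field_simp
  rw [h0, Finset.sum_congr rfl h1, Finset.sum_congr rfl h2, ← Finset.mul_sum, ← Finset.mul_sum]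
  ring

lemma dualBasis_mulVec_block (hN : p + 1 ≤ N) (hg : ∀ i, 1 ≤ i → i ≤ N → g i ≠ 0)
    {h : Fin n → ℂ} (hh : h ≠ 0) (r : Fin p) :
    (fun j => (dualBasis n N p g *ᵥ h) (r, j)) =
        (1 / (g (N - r) * g (N - 1 - r))) • h ∧
      (fun j => (dualBasis n N p g *ᵥ h) (r, j)) ≠ 0 := by
  have hr := r.2
  have e : (fun j => (dualBasis n N p g *ᵥ h) (r, j)) =
      (1 / (g (N - r) * g (N - 1 - r))) • h := by
    ext j
    rw [dualBasis_mulVec, Pi.smul_apply, smul_eq_mul]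
  refine ⟨e, ?_⟩
  rw [e]
  exact smul_ne_zero (one_div_ne_zero (mul_ne_zero (hg _ (by omega) (by omega))
    (hg _ (by omega) (by omega)))) hh

/-! ### Recovery of eigenvectors -/

section Recovery

variable {k μ : ℕ} {x : ℕ → ℂ} {Pc : ℕ → Matrix (Fin n) (Fin n) ℂ}
  {A : Matrix (Fin (μ + 1) × Fin n) (Fin (k - μ - 1) × Fin n) ℂ}
  {B : Matrix (Fin μ × Fin n) (Fin (k - μ) × Fin n) ℂ} {t : OnePoint ℂ}

lemma isRightEigenvector_topBlock (hμ : μ < k)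
    (hg : ∀ i, 1 ≤ i → i ≤ k + 1 → nodeValue x t i ≠ 0)
    {z : (Fin (k - μ) × Fin n) ⊕ (Fin μ × Fin n) → ℂ}
    (hz : IsRightEigenvector 1 (lagrangeLinearization k μ x Pc A B) t z) (i : Fin (k - μ)) :
    IsRightEigenvector k (lagrangePoly k x Pc) t (topBlock z i) := by
  obtain ⟨hz0, hz⟩ := hz
  have hg2 : ∀ i, 1 ≤ i → i ≤ μ + 2 → nodeValue x t i ≠ 0 :=
    fun i h1 h2 => hg i h1 (by omega)
  obtain ⟨y, u, rfl⟩ : ∃ y u, z = Sum.elim y u :=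
    ⟨z ∘ Sum.inl, z ∘ Sum.inr, (Sum.elim_comp_inl_inr z).symm⟩
  rw [valueAt_lagrangeLinearization, Matrix.fromBlocks_mulVec] at hz
  have hz1 := congrArg (· ∘ Sum.inl) hz
  have hz2 := congrArg (· ∘ Sum.inr) hz
  simp only [Sum.elim_comp_inl, Sum.elim_comp_inr, Matrix.zero_mulVec, add_zero,
    Pi.zero_comp] at hz1 hz2
  obtain ⟨h, rfl⟩ := exists_eq_dualBasis_mulVec (by omega) (by omega) hg y hz2
  set K := bidiag n (μ + 2) (μ + 1) μ (nodeValue x t)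
  set Y := dualBasis n (k + 1) (k - μ) (nodeValue x t)
  set M := (body k μ x Pc).map (evalAt 1 t)
  -- The `A` term vanishes because `K₁ y = 0`, and the `B` term is absorbed into the vector
  -- multiplied by `Kᵀ`.
  have hred : M *ᵥ (Y *ᵥ h) + Kᵀ *ᵥ (B *ᵥ (Y *ᵥ h) + u) = 0 := by
    rw [← hz1, Matrix.add_mulVec, Matrix.add_mulVec, ← Matrix.mulVec_mulVec _ A, hz2,
      Matrix.mulVec_zero, add_zero, Matrix.mulVec_add, Matrix.mulVec_mulVec _ Kᵀ B, add_assoc]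
  have hh : h ≠ 0 := by
    rintro rfl
    rw [Matrix.mulVec_zero, Matrix.mulVec_zero, Matrix.mulVec_zero, zero_add, zero_add,
      Matrix.mulVec_transpose] at hred
    have hu := eq_zero_of_vecMul_bidiag rfl le_rfl hg2 u hred
    refine hz0 ?_
    rw [hu, Matrix.mulVec_zero]
    exact Sum.elim_zero_zero
  have hker : barycentricSum k x (nodeValue x t) Pc *ᵥ h = 0 := by
    have h1 := congrArg ((dualBasis n (μ + 2) (μ + 1) (nodeValue x t))ᵀ *ᵥ ·) hred
    simp only [Matrix.mulVec_add, Matrix.mulVec_mulVec, Matrix.mulVec_zero] at h1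
    rw [← Matrix.mul_assoc, dualBasis_mul_body_mul_dualBasis hμ x Pc t hg] at h1
    simp only [← Matrix.mul_assoc] at h1
    rw [← Matrix.transpose_mul, bidiag_mul_dualBasis rfl le_rfl hg2] at h1
    simp only [Matrix.transpose_zero, Matrix.zero_mul, Matrix.zero_mulVec, add_zero,
      Matrix.smul_mulVec] at h1
    exact (smul_eq_zero.mp h1).resolve_left (one_div_ne_zero
      (mul_ne_zero (hg2 _ (by omega) (by omega)) (hg2 _ (by omega) (by omega))))
  obtain ⟨e, hne⟩ := dualBasis_mulVec_block (by omega) hg hh i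
  refine ⟨hne, ?_⟩
  have e' : topBlock (Sum.elim (Y *ᵥ h) u) i = _ := e
  rw [e', valueAt_lagrangePoly k x Pc t (fun i hi => hg i (Finset.mem_Icc.mp hi).1
    (Finset.mem_Icc.mp hi).2), Matrix.mulVec_smul, Matrix.smul_mulVec, hker, smul_zero, smul_zero]

lemma isLeftEigenvector_topBlock (hμ : μ < k)
    (hg : ∀ i, 1 ≤ i → i ≤ k + 1 → nodeValue x t i ≠ 0)
    {w : (Fin (μ + 1) × Fin n) ⊕ (Fin (k - μ - 1) × Fin n) → ℂ}
    (hw : IsLeftEigenvector 1 (lagrangeLinearization k μ x Pc A B) t w) (i : Fin (μ + 1)) :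
    IsLeftEigenvector k (lagrangePoly k x Pc) t (topBlock w i) := by
  obtain ⟨hw0, hw⟩ := hw
  have hg2 : ∀ i, 1 ≤ i → i ≤ μ + 2 → nodeValue x t i ≠ 0 :=
    fun i h1 h2 => hg i h1 (by omega)
  obtain ⟨y, u, rfl⟩ : ∃ y u, w = Sum.elim y u :=
    ⟨w ∘ Sum.inl, w ∘ Sum.inr, (Sum.elim_comp_inl_inr w).symm⟩
  rw [valueAt_lagrangeLinearization, Matrix.vecMul_fromBlocks] at hw
  have hw1 := congrArg (· ∘ Sum.inl) hw
  have hw2 := congrArg (· ∘ Sum.inr) hw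
  simp only [Sum.elim_comp_inl, Sum.elim_comp_inr, Matrix.vecMul_zero, add_zero,
    Pi.zero_comp] at hw1 hw2
  have hw2' := hw2
  rw [Matrix.vecMul_transpose] at hw2'
  obtain ⟨h, rfl⟩ := exists_eq_dualBasis_mulVec rfl le_rfl hg2 y hw2'
  set K := bidiag n (k + 1) (k - μ) (k - μ - 1) (nodeValue x t)
  set S := dualBasis n (μ + 2) (μ + 1) (nodeValue x t)
  set M := (body k μ x Pc).map (evalAt 1 t)
  -- The roles are exchanged: the `B` term vanishes because `y` lies in the kernel of `K₂`, and `A`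
  -- is absorbed.
  have hred : (S *ᵥ h) ᵥ* M + ((S *ᵥ h) ᵥ* A + u) ᵥ* K = 0 := by
    rw [← hw1, Matrix.vecMul_add, Matrix.vecMul_add, ← Matrix.vecMul_vecMul _ _ B, hw2,
      Matrix.zero_vecMul, add_zero, Matrix.add_vecMul, Matrix.vecMul_vecMul _ A K, add_assoc]
  have hh : h ≠ 0 := by
    rintro rfl
    rw [Matrix.mulVec_zero, Matrix.zero_vecMul, Matrix.zero_vecMul, zero_add, zero_add] at hred
    have hu := eq_zero_of_vecMul_bidiag (by omega) (by omega) hg u hred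
    refine hw0 ?_
    rw [hu, Matrix.mulVec_zero]
    exact Sum.elim_zero_zero
  have hker : h ᵥ* barycentricSum k x (nodeValue x t) Pc = 0 := by
    have h1 := congrArg (· ᵥ* dualBasis n (k + 1) (k - μ) (nodeValue x t)) hred
    simp only [Matrix.zero_vecMul] at h1
    rw [Matrix.add_vecMul, Matrix.vecMul_vecMul _ K,
      bidiag_mul_dualBasis (by omega) (by omega) hg, Matrix.vecMul_zero, add_zero,
      ← Matrix.vecMul_transpose, Matrix.vecMul_vecMul, Matrix.vecMul_vecMul,
      ← Matrix.mul_assoc, dualBasis_mul_body_mul_dualBasis hμ x Pc t hg, Matrix.vecMul_smul] at h1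
    exact (smul_eq_zero.mp h1).resolve_left (one_div_ne_zero
      (mul_ne_zero (hg2 _ (by omega) (by omega)) (hg2 _ (by omega) (by omega))))
  obtain ⟨e, hne⟩ := dualBasis_mulVec_block (by omega) hg2 hh i
  refine ⟨hne, ?_⟩
  have e' : topBlock (Sum.elim (S *ᵥ h) u) i = _ := e
  rw [e', valueAt_lagrangePoly k x Pc t (fun i hi => hg i (Finset.mem_Icc.mp hi).1
    (Finset.mem_Icc.mp hi).2), Matrix.smul_vecMul, Matrix.vecMul_smul, hker, smul_zero, smul_zero]

end Recovery

end LagrangeLin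

end

theorem mainTheorem9 (n k μ : ℕ) (hμ : μ < k)
    (x : ℕ → ℂ) (hx : Set.InjOn x (Set.Icc 1 (k + 1)))
    (Pc : ℕ → Matrix (Fin n) (Fin n) ℂ)
    (hreg : LagrangeLin.IsRegular (LagrangeLin.lagrangePoly k x Pc))
    (A : Matrix (Fin (μ + 1) × Fin n) (Fin (k - μ - 1) × Fin n) ℂ)
    (B : Matrix (Fin μ × Fin n) (Fin (k - μ) × Fin n) ℂ)
    (t : OnePoint ℂ)
    (ht : LagrangeLin.IsEigenvalue k (LagrangeLin.lagrangePoly k x Pc) t)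
    (htx : ∀ i ∈ Set.Icc 1 (k + 1), t ≠ (x i : OnePoint ℂ)) :
    (∀ z : (Fin (k - μ) × Fin n) ⊕ (Fin μ × Fin n) → ℂ,
      LagrangeLin.IsRightEigenvector 1 (LagrangeLin.lagrangeLinearization k μ x Pc A B) t z →
        ∀ i : Fin (k - μ),
          LagrangeLin.IsRightEigenvector k (LagrangeLin.lagrangePoly k x Pc) t
            (LagrangeLin.topBlock z i)) ∧
    (∀ ω : (Fin (μ + 1) × Fin n) ⊕ (Fin (k - μ - 1) × Fin n) → ℂ,
      LagrangeLin.IsLeftEigenvector 1 (LagrangeLin.lagrangeLinearization k μ x Pc A B) t ω →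
        ∀ i : Fin (μ + 1),
          LagrangeLin.IsLeftEigenvector k (LagrangeLin.lagrangePoly k x Pc) t
            (LagrangeLin.topBlock ω i)) := by
  have hg : ∀ i, 1 ≤ i → i ≤ k + 1 → LagrangeLin.nodeValue x t i ≠ 0 :=
    fun i h1 h2 => LagrangeLin.nodeValue_ne_zero x t i (htx i ⟨h1, h2⟩)
  exact ⟨fun _ hz i => LagrangeLin.isRightEigenvector_topBlock hμ hg hz i,
    fun _ hw i => LagrangeLin.isLeftEigenvector_topBlock hμ hg hw i⟩
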